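/- **Lemma 3.1.** Let $G$ be a finite connected plane graph (loops and parallel edges allowed) with nonnegative edge weights, and let $F_1,\dots,F_f$ be $f$ distinct faces of $G$ such that the boundary of each $F_r$ is a simple cycle, these $f$ cycles are pairwise vertex-disjoint, and the set of their vertices is exactly the set $T$ of terminals. For all terminals $s,s'$ fix a shortest $s$-$s'$ path $P_{s,s'}$ in $G$, such that any two of these paths with the same start $s$ coincide from $s$ up to each vertex that they have in common (this holds automatically if shortest paths in $G$ are unique). Let $t$ be a terminal, let $F_r$ be a face that does not contain $t$ on its boundary, and let $t^r_1,\dots,t^r_m$ be the terminals on $F_r$ in clockwise order (indices modulo $m$). The paths $P_{t,t^r_j}$ and $P_{t,t^r_{j+1}}$ are called *equivalent* if the region enclosed by the union of these two paths and the boundary edge of $F_r$ going clockwise from $t^r_j$ to $t^r_{j+1}$ (that is, the points not in the unbounded component of the complement of this union) contains none of the faces $F_1,\dots,F_f$. The path $P_{t,t^r_j}$ is called *critical* if it is not equivalent to $P_{t,t^r_{j+1}}$ or not equivalent to $P_{t,t^r_{j-1}}$. Then for every terminal $t$ the number of critical paths $P_{t,t'}$ from $t$ is at most $8f-4$; in particular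 it is $O(f)$. -/

import Mathlib

/-- A finite multigraph (loops and parallel edges allowed) drawn on an oriented closed surface,
given combinatorially by its rotation system.  Every edge is a pair `d`, `rev d` of oppositely
oriented darts, `src d` is the vertex a dart leaves, and `rot` is the circular order of the darts
around each vertex. -/
structure EmbeddedGraph (V D : Type*) where
  src : D → V
  rev : D → D
  rev_rev : ∀ d, rev (rev d) = d
  rev_ne : ∀ d, rev d ≠ d
  rot : Equiv.Perm D
  /-- The darts leaving one vertex form exactly one cycle of the rotation. -/
  sameCycle_rot_iff : ∀ d e, rot.SameCycle d e ↔ src d = src e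

namespace EmbeddedGraph

variable {V D : Type*} (G : EmbeddedGraph V D)

/-- The vertex at which a dart ends. -/
def tgt (d : D) : V := G.src (G.rev d)

/-- Reversal of darts as a permutation. -/
def revPerm : Equiv.Perm D := ⟨G.rev, G.rev, G.rev_rev, G.rev_rev⟩

/-- The successor of a dart along the boundary walk of the face next to it: reverse the dart, then
take the next dart in the rotation at its end. -/
def facePerm : Equiv.Perm D := G.rot * G.revPerm

/-- Faces are the cycles of the face permutation. -/
def Face : Type _ := Quotient (Equiv.Perm.SameCycle.setoid G.facePerm)

/-- The face whose boundary walk uses the dart `d`.  The two faces on the two sides of the edge of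
`d` are `G.faceOf d` and `G.faceOf (G.rev d)`. -/
def faceOf (d : D) : G.Face := Quotient.mk (Equiv.Perm.SameCycle.setoid G.facePerm) d

/-- `v` lies on the boundary of the face `F`. -/
def OnFace (v : V) (F : G.Face) : Prop := ∃ d, G.faceOf d = F ∧ G.src d = v

/-- A connected graph with at least one edge embedded in the sphere: Euler's formula
`|V| - |E| + |F| = 2`, where `|D| = 2 |E|`. -/
structure IsPlane [Fintype V] [Fintype D] : Prop where
  connected : ∀ u v : V,
    Relation.ReflTransGen (fun x y => ∃ d, G.src d = x ∧ G.tgt d = y) u v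
  euler : 2 * Fintype.card V + 2 * Nat.card G.Face = Fintype.card D + 4

/-! ### Walks, paths, shortest paths -/

/-- `G.IsWalk u p v`: the list of darts `p` is a walk from `u` to `v`. -/
def IsWalk : V → List D → V → Prop
  | u, [], v => u = v
  | u, d :: p, v => G.src d = u ∧ IsWalk (G.tgt d) p v

/-- A path is a walk without repeated vertices. -/
def IsPath (u : V) (p : List D) (v : V) : Prop :=
  G.IsWalk u p v ∧ (u :: p.map G.tgt).Nodup

/-- `p` is a `u`-`v` path of minimum total weight. -/
def IsShortestPath (w : D → ℝ) (u : V) (p : List D) (v : V) : Prop :=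
  G.IsPath u p v ∧ ∀ q, G.IsPath u q v → (p.map w).sum ≤ (q.map w).sum

/-- Edge weights: nonnegative reals, the same for both orientations of an edge. -/
structure IsWeight (w : D → ℝ) : Prop where
  nonneg : ∀ d, 0 ≤ w d
  rev : ∀ d, w (G.rev d) = w d

/-- A choice `P s t` of a shortest path for all terminals `s`, `t`, where ties are broken
consistently: two chosen paths with the same start meet exactly in a common initial subpath, that
is, up to any common vertex `v` they coincide.  If shortest paths are unique then they form such a
system, see `isShortestPathSystem_of_unique`. -/
structure IsShortestPathSystem (w : D → ℝ) (T : Finset V) (P : V → V → List D) : Prop where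
  shortest : ∀ s ∈ T, ∀ t ∈ T, G.IsShortestPath w s (P s t) t
  consistent : ∀ s ∈ T, ∀ a ∈ T, ∀ b ∈ T, ∀ (v : V) (p q : List D),
    p <+: P s a → q <+: P s b → G.IsWalk s p v → G.IsWalk s q v → p = q

/-! ### Terminals on faces -/

/-- The terminals `T` lie on the faces in `S`, so this is an `f`-face instance with
`f = S.card`. The boundary of each face in `S` is a simple cycle that contains only terminals, and
these cycles are vertex-disjoint. -/
structure IsFaceInstance (T : Finset V) (S : Finset G.Face) : Prop where
  terminal_onFace : ∀ t ∈ T, ∃ F ∈ S, G.OnFace t F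
  boundary_terminal : ∀ F ∈ S, ∀ v, G.OnFace v F → v ∈ T
  /-- The boundary walk of the face repeats no vertex... -/
  boundary_vertex : ∀ d e, G.faceOf d ∈ S → G.faceOf d = G.faceOf e → G.src d = G.src e → d = e
  /-- ... and no edge. -/
  boundary_edge : ∀ d, G.faceOf d ∈ S → G.faceOf (G.rev d) ≠ G.faceOf d
  boundary_disjoint : ∀ F ∈ S, ∀ F' ∈ S, ∀ v, G.OnFace v F → G.OnFace v F' → F = F'

/-- The face `F` lies in the region enclosed by the edges in `U`, where `o` is the outer (unbounded)
face. Two faces lie in the same component of the complement of the drawing of `U` iff one can walk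
from one to the other from face to face, crossing only edges that are not in `U`; the region
enclosed by `U` is everything outside the component of the outer face. -/
def Encloses (o : G.Face) (U : List D) (F : G.Face) : Prop :=
  ¬ Relation.ReflTransGen
    (fun A B => ∃ d, d ∉ U ∧ G.rev d ∉ U ∧ G.faceOf d = A ∧ G.faceOf (G.rev d) = B) o F

/-- Let `d` be a boundary dart of a face in `S`; it is the boundary segment between the consecutive
terminals `src d` and `tgt d` of that face. The chosen paths from `t` to these two terminals are
equivalent: the region enclosed by the two paths and the segment contains no face in `S`. -/
def EquivalentAlong (o : G.Face) (S : Finset G.Face) (P : V → V → List D) (t : V) (d : D) : Prop :=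
  ∀ F ∈ S, ¬ G.Encloses o (P t (G.src d) ++ P t (G.tgt d) ++ [d]) F

/-- The chosen path from `t` to `t'` is critical: `t'` lies on a face of `S` that `t` does not lie
on, and the path is not equivalent to the path to the next terminal on that face, or not equivalent
to the path to the previous one. Here `d` is the boundary dart of the face that leaves `t'`, and
`G.facePerm.symm d` is the one that enters `t'`. -/
def IsCritical (o : G.Face) (S : Finset G.Face) (P : V → V → List D) (t t' : V) : Prop :=
  ∃ d, G.faceOf d ∈ S ∧ ¬ G.OnFace t (G.faceOf d) ∧ G.src d = t' ∧
    (¬ G.EquivalentAlong o S P t d ∨ ¬ G.EquivalentAlong o S P t (G.facePerm.symm d))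

/-! ### Unique shortest paths form a system -/

variable {G}

theorem IsWalk.append {u v x : V} {p q : List D} (hp : G.IsWalk u p v) (hq : G.IsWalk v q x) :
    G.IsWalk u (p ++ q) x := by
  induction p generalizing u with
  | nil => cases hp; exact hq
  | cons d p ih => exact ⟨hp.1, ih hp.2⟩

theorem IsWalk.split {u x : V} {p q : List D} (h : G.IsWalk u (p ++ q) x) :
    ∃ v, G.IsWalk u p v ∧ G.IsWalk v q x := by
  induction p generalizing u with
  | nil => exact ⟨u, rfl, h⟩
  | cons d p ih =>
    obtain ⟨v, h1, h2⟩ := ih h.2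
    exact ⟨v, ⟨h.1, h1⟩, h2⟩

theorem IsWalk.end_unique {u v x : V} {p : List D} (h : G.IsWalk u p v) (h' : G.IsWalk u p x) :
    v = x := by
  induction p generalizing u with
  | nil => cases h; exact h'
  | cons d p ih => exact ih h.2 h'.2

/-- A vertex of a walk is reached by some initial part of it. -/
theorem IsWalk.exists_split {u x y : V} {p : List D} (h : G.IsWalk u p x)
    (hy : y ∈ u :: p.map G.tgt) : ∃ p₁ p₂, p = p₁ ++ p₂ ∧ G.IsWalk y p₂ x := by
  induction p generalizing u with
  | nil =>
    have : y = u := by simpa using hy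
    subst this
    exact ⟨[], [], rfl, h⟩
  | cons d p ih =>
    rcases List.mem_cons.1 hy with rfl | hy
    · exact ⟨[], d :: p, rfl, h⟩
    · obtain ⟨p₁, p₂, rfl, h2⟩ := ih h.2 (by simpa using hy)
      exact ⟨d :: p₁, p₂, rfl, h2⟩

theorem IsWalk.exists_path {w : D → ℝ} (hw : G.IsWeight w) {u x : V} {p : List D}
    (h : G.IsWalk u p x) : ∃ q, G.IsPath u q x ∧ (q.map w).sum ≤ (p.map w).sum := by
  induction p generalizing u with
  | nil => exact ⟨[], ⟨h, by simp⟩, le_rfl⟩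
  | cons d p ih =>
    obtain ⟨q, hq, hle⟩ := ih h.2
    have hd := hw.nonneg d
    by_cases hu : u ∈ G.tgt d :: q.map G.tgt
    · obtain ⟨q₁, q₂, rfl, h2⟩ := hq.1.exists_split hu
      have h0 : 0 ≤ (q₁.map w).sum :=
        List.sum_nonneg (by simp only [List.mem_map]; rintro _ ⟨e, _, rfl⟩; exact hw.nonneg e)
      refine ⟨q₂, ⟨h2, List.nodup_cons.2 ⟨?_, ?_⟩⟩, ?_⟩
      · intro hmem
        obtain ⟨v, h1, h2'⟩ := hq.1.split
        have hnd := hq.2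
        rw [List.map_append, ← List.cons_append, List.nodup_append] at hnd
        rcases List.mem_append.1 (by simpa [List.cons_append] using hu :
          u ∈ (G.tgt d :: q₁.map G.tgt) ++ q₂.map G.tgt) with h3 | h3
        · exact hnd.2.2 _ h3 _ hmem rfl
        · have hne : ∀ {a b : V} {r : List D}, G.IsWalk a r b → b ∈ a :: r.map G.tgt := by
            intro a b r hr
            induction r generalizing a with
            | nil => cases hr; simp
            | cons e r ihr => exact List.mem_cons_of_mem _ (by simpa using ihr hr.2)
          have hvu : ∀ {a b c : V} {r : List D}, G.IsWalk a r c → G.IsWalk b r c →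
              r ≠ [] → a = b := by
            intro a b c r ha hb hr
            cases r with
            | nil => exact absurd rfl hr
            | cons e r => exact ha.1.symm.trans hb.1
          have hq2 : q₂ ≠ [] := by rintro rfl; simp at h3
          have := hvu h2 h2' hq2
          subst this
          exact hnd.2.2 _ (hne h1) _ hmem rfl
      · have hnd := hq.2
        rw [List.map_append, ← List.cons_append, List.nodup_append] at hnd
        exact hnd.2.1
      · simp only [List.map_append, List.sum_append, List.map_cons, List.sum_cons] at hle ⊢
        linarith
    · exact ⟨d :: q, ⟨⟨h.1, hq.1⟩, by simpa using List.nodup_cons.2 ⟨hu, hq.2⟩⟩,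
        by simpa using hle⟩

/-- If shortest paths between any two vertices are unique, then they form a consistent system. -/
theorem isShortestPathSystem_of_unique {w : D → ℝ} (hw : G.IsWeight w) (T : Finset V)
    (P : V → V → List D) (hP : ∀ u v, G.IsShortestPath w u (P u v) v)
    (huniq : ∀ u v p, G.IsShortestPath w u p v → p = P u v) :
    G.IsShortestPathSystem w T P := by
  have key : ∀ (s a v : V) (p : List D), p <+: P s a → G.IsWalk s p v → p = P s v := by
    rintro s a v p ⟨r, hr⟩ hp
    apply huniq
    have hs := hP s a
    rw [← hr] at hs
    obtain ⟨v', h1, h2⟩ := hs.1.1.split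
    obtain rfl := hp.end_unique h1
    refine ⟨⟨hp, ?_⟩, fun q hq => ?_⟩
    · have hnd := hs.1.2
      rw [List.map_append, ← List.cons_append, List.nodup_append] at hnd
      exact hnd.1
    · obtain ⟨q', hq', hle⟩ := (hq.1.append h2).exists_path hw
      have := hs.2 q' hq'
      simp only [List.map_append, List.sum_append] at this hle
      linarith
  exact ⟨fun s _ t _ => hP s t, fun s _ a _ b _ v p q hp hq h1 h2 =>
    (key s a v p hp h1).trans (key s b v q hq h2).symm⟩

end EmbeddedGraph

/-!
The chosen paths from `t` form a tree `𝒯` rooted at `t`, and a tree does not separate the faces: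
going around the lower end `v` of a tree edge, one passes from one side of that edge to its other
side by crossing only non-tree edges and tree edges below `v`, so by induction from the leaves
upwards the two sides of every edge are joined in the dual graph without the edges of `𝒯`
(`dualReach_sides`).  Hence this dual graph is connected (`dualReach_all`), and it has a
spanning tree `B` rooted at the outer face `o` (`exists_parentDart`).

The edges of the two paths to the ends of a boundary dart `d` lie in `𝒯`.  So if a face of `S` is
enclosed by these paths and `d`, then the path in `B` from this face to `o` crosses `d`
(`exists_chain_dart`).  Now let `A ∈ S` be the face of `d`.  Either `d` leads from `A` to its
parent in `B`, which happens for at most one `d` per `A`; or `d` leads to a child of `A` with a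
face of `S` below it, and then `d` is, for a suitable `F ∈ S`, the step by which the path in `B`
from `F` upwards first enters another face of `S`.  This makes at most `2 * S.card` inequivalent
boundary darts (`ncard_inequivalent_le`), thus at most `4 * S.card` critical paths, which is
enough because `S` is nonempty.
-/

namespace EmbeddedGraph

variable {V D : Type*} {G : EmbeddedGraph V D}

/-! ### Crossing edges outside a given set -/

/-- The faces `A` and `B` are joined by crossing an edge neither of whose darts is in `X`. -/
def DualStep (G : EmbeddedGraph V D) (X : Set D) (A B : G.Face) : Prop :=
  ∃ d, d ∉ X ∧ G.rev d ∉ X ∧ G.faceOf d = A ∧ G.faceOf (G.rev d) = B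

/-- `B` can be reached from `A` by crossing only edges neither of whose darts is in `X`. -/
def DualReach (G : EmbeddedGraph V D) (X : Set D) : G.Face → G.Face → Prop :=
  Relation.ReflTransGen (G.DualStep X)

theorem DualReach.symm {X : Set D} {A B : G.Face} (h : G.DualReach X A B) :
    G.DualReach X B A := by
  have hs : Std.Symm (G.DualStep X) := ⟨fun _ _ ⟨d, h1, h2, h3, h4⟩ =>
    ⟨G.rev d, h2, by rwa [G.rev_rev], h4, by rwa [G.rev_rev]⟩⟩
  exact (Relation.ReflTransGen.stdSymm (r := G.DualStep X)).symm _ _ h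

theorem faceOf_facePerm (d : D) : G.faceOf (G.facePerm d) = G.faceOf d :=
  Quotient.sound (s := Equiv.Perm.SameCycle.setoid G.facePerm)
    ((Equiv.Perm.SameCycle.refl G.facePerm d).apply_left)

/-- Rotating a dart by one step changes its face to the one on the other side. -/
theorem faceOf_rot (d : D) : G.faceOf (G.rot d) = G.faceOf (G.rev d) := by
  have h := G.faceOf_facePerm (G.rev d)
  have h2 : G.facePerm (G.rev d) = G.rot d := by
    show G.rot (G.rev (G.rev d)) = _
    rw [G.rev_rev]
  rwa [h2] at h

theorem src_rot_pow (d : D) (n : ℕ) : G.src ((G.rot ^ n) d) = G.src d :=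
  (G.sameCycle_rot_iff _ _).1 ((Equiv.Perm.SameCycle.refl G.rot d).pow_left)

/-- If all edges at a vertex except that of `y` can be bypassed, then so can the edge of `y`, by
going around the vertex. -/
theorem dualReach_around [Finite D] {X : Set D} (y : D)
    (h : ∀ x, G.src x = G.src y → x ≠ y → G.DualReach X (G.faceOf x) (G.faceOf (G.rev x))) :
    G.DualReach X (G.faceOf (G.rev y)) (G.faceOf y) := by
  rw [← faceOf_rot]
  have key : ∀ k : ℕ, G.DualReach X (G.faceOf (G.rot y)) (G.faceOf ((G.rot ^ (k + 1)) y)) ∨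
      G.DualReach X (G.faceOf (G.rot y)) (G.faceOf y) := by
    intro k
    induction k with
    | zero => exact Or.inl (by rw [zero_add, pow_one]; exact Relation.ReflTransGen.refl)
    | succ k ih =>
      rcases ih with ih | ih
      · by_cases hx : (G.rot ^ (k + 1)) y = y
        · exact Or.inr (by rwa [hx] at ih)
        · have h1 := h _ (src_rot_pow y (k + 1)) hx
          rw [← faceOf_rot] at h1
          rw [pow_succ' _ (k + 1), Equiv.Perm.mul_apply]
          exact Or.inl (ih.trans h1)
      · exact Or.inr ih
  rcases key (orderOf G.rot - 1) with h1 | h1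
  · rwa [Nat.sub_add_cancel (orderOf_pos G.rot), pow_orderOf_eq_one] at h1
  · exact h1

/-- If every single edge can be bypassed in a connected graph, then all faces are joined. -/
theorem dualReach_of_sides [Finite D] {X : Set D}
    (hconn : ∀ u v : V, Relation.ReflTransGen (fun x y => ∃ d, G.src d = x ∧ G.tgt d = y) u v)
    (h : ∀ d, G.DualReach X (G.faceOf d) (G.faceOf (G.rev d))) (A B : G.Face) :
    G.DualReach X A B := by
  have hvert : ∀ x y : D, G.src x = G.src y → G.DualReach X (G.faceOf x) (G.faceOf y) := by
    intro x y hxy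
    obtain ⟨n, rfl⟩ := ((G.sameCycle_rot_iff x y).2 hxy).exists_nat_pow_eq
    clear hxy
    induction n with
    | zero => exact Relation.ReflTransGen.refl
    | succ n ih =>
      rw [pow_succ', Equiv.Perm.mul_apply, faceOf_rot]
      exact ih.trans (h _)
  obtain ⟨x, rfl⟩ := Quotient.exists_rep A
  obtain ⟨y, rfl⟩ := Quotient.exists_rep B
  have key : ∀ v, Relation.ReflTransGen (fun x y => ∃ d, G.src d = x ∧ G.tgt d = y) (G.src x) v →
      ∀ z, G.src z = v → G.DualReach X (G.faceOf x) (G.faceOf z) := by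
    intro v hv
    induction hv with
    | refl => exact fun z hz => hvert x z hz.symm
    | tail _ hstep ih =>
      obtain ⟨d, hd1, hd2⟩ := hstep
      exact fun z hz => ((ih d hd1).trans (h d)).trans (hvert _ z (hd2.trans hz.symm))
  exact key _ (hconn _ _) y rfl

/-! ### The tree of chosen paths does not separate the faces -/

/-- The darts of the chosen paths from `t`, directed away from `t`. -/
def treeDarts (P : V → V → List D) (T : Finset V) (t : V) : Set D :=
  {e | ∃ b ∈ T, e ∈ P t b}

theorem IsWalk.exists_src {u x : V} {p q : List D} {e : D} (h : G.IsWalk u (p ++ e :: q) x) :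
    G.IsWalk u p (G.src e) ∧ G.IsWalk u (p ++ [e]) (G.tgt e) := by
  obtain ⟨v, h1, h2⟩ := h.split
  obtain rfl : G.src e = v := h2.1
  exact ⟨h1, h1.append ⟨rfl, rfl⟩⟩

section Tree

variable [Fintype V] [Fintype D] {w : D → ℝ} {T : Finset V} {P : V → V → List D} {t : V}

/-- The two sides of every edge are joined in the dual graph without the edges of the tree. -/
theorem dualReach_sides (hP : G.IsShortestPathSystem w T P) (ht : t ∈ T) (d : D) :
    G.DualReach (treeDarts P T t) (G.faceOf d) (G.faceOf (G.rev d)) := by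
  -- The depth `p.length` of a tree dart is less than `card V`; the induction starts at the leaves.
  have key : ∀ (n : ℕ) (p q : List D) (e : D) (b : V), b ∈ T → P t b = p ++ e :: q →
      Fintype.card V ≤ p.length + n →
      G.DualReach (treeDarts P T t) (G.faceOf e) (G.faceOf (G.rev e)) := by
    intro n
    induction n with
    | zero =>
      intro p q e b hb hpq hn
      have h := ((hP.shortest t ht b hb).1.2).length_le_card
      simp only [hpq, List.length_cons, List.length_map, List.length_append] at h
      omega
    | succ n ih =>
      intro p q e b hb hpq hn
      have hwalk := (hP.shortest t ht b hb).1.1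
      rw [hpq] at hwalk
      have hpre : p ++ [e] <+: P t b := ⟨q, by simp [hpq]⟩
      have hend := hwalk.exists_src.2
      have := G.dualReach_around (X := treeDarts P T t) (G.rev e) ?_
      · rwa [G.rev_rev] at this
      intro x hx hne
      by_cases hx1 : x ∈ treeDarts P T t
      · -- `x` is a tree dart leaving the end of `e`, so it lies deeper in the tree.
        obtain ⟨c, hc, hxc⟩ := hx1
        obtain ⟨p', q', hpq'⟩ := List.append_of_mem hxc
        have hw' := (hP.shortest t ht c hc).1.1
        rw [hpq'] at hw'
        have h1 := hw'.exists_src.1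
        rw [hx] at h1
        have heq := hP.consistent t ht b hb c hc _ _ _ hpre ⟨_, hpq'.symm⟩ hend h1
        refine ih p' q' x c hc hpq' ?_
        rw [← heq]
        simp only [List.length_append, List.length_singleton]
        omega
      · by_cases hx2 : G.rev x ∈ treeDarts P T t
        · -- Only one tree dart enters the end of `e`.
          obtain ⟨c, hc, hxc⟩ := hx2
          obtain ⟨p', q', hpq'⟩ := List.append_of_mem hxc
          have hw' := (hP.shortest t ht c hc).1.1
          rw [hpq'] at hw'
          have h1 := hw'.exists_src.2
          have htgt : G.tgt (G.rev x) = G.tgt e := by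
            unfold tgt
            rw [G.rev_rev, hx]
          rw [htgt] at h1
          have heq := hP.consistent t ht b hb c hc _ _ _ hpre ⟨q', by simp [hpq']⟩ hend h1
          have he : e = G.rev x := by simpa using (List.append_inj' heq rfl).2
          exact absurd (by rw [he, G.rev_rev]) hne
        · exact Relation.ReflTransGen.single ⟨x, hx1, hx2, rfl, rfl⟩
  by_cases h1 : d ∈ treeDarts P T t
  · obtain ⟨b, hb, hd⟩ := h1
    obtain ⟨p, q, hpq⟩ := List.append_of_mem hd
    exact key _ p q d b hb hpq (Nat.le_add_left _ _)
  · by_cases h2 : G.rev d ∈ treeDarts P T t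
    · obtain ⟨b, hb, hd⟩ := h2
      obtain ⟨p, q, hpq⟩ := List.append_of_mem hd
      have := key _ p q _ b hb hpq (Nat.le_add_left _ _)
      rw [G.rev_rev] at this
      exact this.symm
    · exact Relation.ReflTransGen.single ⟨d, h1, h2, rfl, rfl⟩

theorem dualReach_all (hG : G.IsPlane) (hP : G.IsShortestPathSystem w T P) (ht : t ∈ T)
    (A B : G.Face) : G.DualReach (treeDarts P T t) A B :=
  dualReach_of_sides hG.connected (dualReach_sides hP ht) A B

end Tree

/-! ### A rooted spanning tree of the dual graph -/

/-- `B` is reached from `A` by crossing exactly `n` edges neither of whose darts is in `X`. -/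
def DualReachIn (G : EmbeddedGraph V D) (X : Set D) (A : G.Face) : ℕ → G.Face → Prop
  | 0, B => B = A
  | n + 1, B => ∃ C, DualReachIn G X A n C ∧ G.DualStep X C B

theorem DualReach.exists_dualReachIn {X : Set D} {A B : G.Face} (h : G.DualReach X A B) :
    ∃ n, G.DualReachIn X A n B := by
  induction h with
  | refl => exact ⟨0, rfl⟩
  | tail _ hstep ih =>
    obtain ⟨n, hn⟩ := ih
    exact ⟨n + 1, _, hn, hstep⟩

/-- A breadth-first spanning tree of the dual graph: for each face `A` other than the root `o`, the
dart `π A` crosses from the parent of `A` to `A`, and the parent is closer to the root. -/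
theorem exists_parentDart {X : Set D} {o : G.Face} (h : ∀ A, G.DualReach X o A) :
    ∃ (depth : G.Face → ℕ) (π : G.Face → D), ∀ A, A ≠ o →
      π A ∉ X ∧ G.rev (π A) ∉ X ∧ G.faceOf (G.rev (π A)) = A ∧
        depth (G.faceOf (π A)) < depth A := by
  classical
  have hn := fun A => (h A).exists_dualReachIn
  have step : ∀ A, ∃ e : D, A ≠ o → e ∉ X ∧ G.rev e ∉ X ∧ G.faceOf (G.rev e) = A ∧
      Nat.find (hn (G.faceOf e)) < Nat.find (hn A) := by
    intro A
    by_cases hA : A = o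
    · obtain ⟨e, -⟩ := Quotient.exists_rep A
      exact ⟨e, fun h => absurd hA h⟩
    · have hspec := Nat.find_spec (hn A)
      cases hk : Nat.find (hn A) with
      | zero =>
        rw [hk] at hspec
        exact absurd hspec hA
      | succ k =>
        rw [hk] at hspec
        obtain ⟨C, hC, e, h1, h2, rfl, h4⟩ := hspec
        exact ⟨e, fun _ => ⟨h1, h2, h4, Nat.lt_succ_of_le (Nat.find_min' _ hC)⟩⟩
  choose π hπ using step
  exact ⟨fun A => Nat.find (hn A), π, hπ⟩

/-- If the face `F` is cut off from the root by the edges in `X` and that of `d`, then the path from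
`F` to the root in the spanning tree crosses `d`. -/
theorem exists_chain_dart {X Y : Set D} {o : G.Face} {depth : G.Face → ℕ} {π : G.Face → D}
    (hπ : ∀ A, A ≠ o → π A ∉ X ∧ G.rev (π A) ∉ X ∧ G.faceOf (G.rev (π A)) = A ∧
        depth (G.faceOf (π A)) < depth A)
    {d : D} (hY : ∀ e ∈ Y, e ∈ X ∨ e = d) (F : G.Face) (hF : ¬ G.DualReach Y o F) :
    ∃ k, (fun A => G.faceOf (π A))^[k] F ≠ o ∧
      (π ((fun A => G.faceOf (π A))^[k] F) = d ∨
        π ((fun A => G.faceOf (π A))^[k] F) = G.rev d) := by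
  induction hn : depth F using Nat.strong_induction_on generalizing F with
  | _ n ih =>
    have hFo : F ≠ o := by
      rintro rfl
      exact hF Relation.ReflTransGen.refl
    obtain ⟨h1, h2, h3, h4⟩ := hπ F hFo
    by_cases hd : π F = d ∨ π F = G.rev d
    · exact ⟨0, hFo, hd⟩
    · push Not at hd
      have hY1 : π F ∉ Y := fun h => (hY _ h).elim h1 hd.1
      have hY2 : G.rev (π F) ∉ Y := fun h => (hY _ h).elim h2 fun h => hd.2 (by
        rw [← h, G.rev_rev])
      have hpar : ¬ G.DualReach Y o (G.faceOf (π F)) := fun h =>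
        hF (h.tail ⟨π F, hY1, hY2, rfl, h3⟩)
      obtain ⟨k, hk⟩ := ih _ (hn ▸ h4) _ hpar rfl
      exact ⟨k + 1, hk⟩

/-! ### Counting inequivalent boundary darts -/

/-- At most `2 * S.card` boundary darts of faces in `S` join endpoints of inequivalent paths. -/
theorem ncard_inequivalent_le [Fintype V] [Fintype D] (hG : G.IsPlane) (o : G.Face) {w : D → ℝ}
    {T : Finset V} {S : Finset G.Face} (hS : G.IsFaceInstance T S) {P : V → V → List D}
    (hP : G.IsShortestPathSystem w T P) {t : V} (ht : t ∈ T) :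
    {d : D | G.faceOf d ∈ S ∧ ¬ G.EquivalentAlong o S P t d}.ncard ≤ 2 * S.card := by
  obtain ⟨depth, π, hπ⟩ := exists_parentDart (fun A => dualReach_all hG hP ht o A)
  set par : G.Face → G.Face := fun A => G.faceOf (π A) with hpar
  -- The darts towards the parent, and the darts `d` towards a child such that the path in the
  -- spanning tree from some `F ∈ S` upwards has `d` as its first step into a face of `S`.
  let up : Set D := {d | G.faceOf d ∈ S ∧ π (G.faceOf d) = G.rev d}
  let down : Set D := {d | G.faceOf d ∈ S ∧
    ∃ F ∈ S, ∃ k, π (par^[k] F) = d ∧ ∀ j < k, par^[j + 1] F ∉ S}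
  have hup : up.ncard ≤ S.card := by
    rw [← Set.ncard_coe_finset S]
    refine Set.ncard_le_ncard_of_injOn G.faceOf (fun d hd => hd.1) ?_ S.finite_toSet
    intro d hd e he hde
    have h := hd.2
    rw [hde, he.2] at h
    rw [← G.rev_rev d, ← h, G.rev_rev]
  have hdown : down.ncard ≤ S.card := by
    have hex : ∀ d, ∃ F, d ∈ down → F ∈ S ∧ ∃ k, π (par^[k] F) = d ∧
        ∀ j < k, par^[j + 1] F ∉ S := by
      intro d
      by_cases hd : d ∈ down
      · obtain ⟨F, hF, h⟩ := hd.2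
        exact ⟨F, fun _ => ⟨hF, h⟩⟩
      · exact ⟨G.faceOf d, fun h => absurd h hd⟩
    choose g hg using hex
    rw [← Set.ncard_coe_finset S]
    refine Set.ncard_le_ncard_of_injOn g (fun d hd => (hg d hd).1) ?_ S.finite_toSet
    intro d hd e he hde
    obtain ⟨k, hk1, hk2⟩ := (hg d hd).2
    obtain ⟨l, hl1, hl2⟩ := (hg e he).2
    rw [← hde] at hl1 hl2
    have hkS : par^[k + 1] (g d) ∈ S := by
      rw [Function.iterate_succ_apply', hpar]
      simpa only [← hpar, hk1] using hd.1
    have hlS : par^[l + 1] (g d) ∈ S := by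
      rw [Function.iterate_succ_apply', hpar]
      simpa only [← hpar, hl1] using he.1
    rcases lt_trichotomy k l with h | h | h
    · exact absurd hkS (hl2 k h)
    · rw [← hk1, ← hl1, h]
    · exact absurd hlS (hk2 l h)
  have hsub : {d : D | G.faceOf d ∈ S ∧ ¬ G.EquivalentAlong o S P t d} ⊆ up ∪ down := by
    rintro d ⟨hd, hne⟩
    unfold EquivalentAlong at hne
    push Not at hne
    obtain ⟨F, hFS, hF⟩ := hne
    have hsrc : G.src d ∈ T := hS.boundary_terminal _ hd _ ⟨d, rfl, rfl⟩
    have htgt : G.tgt d ∈ T :=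
      hS.boundary_terminal _ hd _ ⟨G.facePerm d, faceOf_facePerm d, by
        show G.src (G.rot (G.rev d)) = G.src (G.rev d)
        simpa using src_rot_pow (G.rev d) 1⟩
    obtain ⟨k, hko, hk⟩ := exists_chain_dart
      (Y := {e | e ∈ P t (G.src d) ++ P t (G.tgt d) ++ [d]}) (d := d) hπ (by
        intro e he
        simp only [Set.mem_ofPred_eq, List.mem_append, List.mem_singleton] at he
        rcases he with (he | he) | he
        · exact Or.inl ⟨_, hsrc, he⟩
        · exact Or.inl ⟨_, htgt, he⟩
        · exact Or.inr he) F hF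
    rcases hk with hk | hk
    · -- Starting from the face of `S` nearest below `d` makes `d` the first step into `S`.
      right
      classical
      have hex : ∃ k, ∃ F ∈ S, π (par^[k] F) = d := ⟨k, F, hFS, hk⟩
      obtain ⟨F', hF', hk'⟩ := Nat.find_spec hex
      refine ⟨hd, F', hF', _, hk', fun j hj hjS => ?_⟩
      refine Nat.find_min hex (m := Nat.find hex - (j + 1)) (by omega) ⟨_, hjS, ?_⟩
      rw [← Function.iterate_add_apply, Nat.sub_add_cancel hj]
      exact hk'
    · left
      have h3 := (hπ _ hko).2.2.1
      rw [hk, G.rev_rev] at h3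
      exact ⟨hd, by rw [h3, hk]⟩
  calc _ ≤ (up ∪ down).ncard := Set.ncard_le_ncard hsub (Set.toFinite _)
    _ ≤ up.ncard + down.ncard := Set.ncard_union_le _ _
    _ ≤ 2 * S.card := by omega

end EmbeddedGraph

theorem lemma3p1 {V D : Type*} [Fintype V] [Fintype D]
    (G : EmbeddedGraph V D) (hG : G.IsPlane) (o : G.Face)
    (w : D → ℝ) (hw : G.IsWeight w)
    (T : Finset V) (S : Finset G.Face) (hS : G.IsFaceInstance T S)
    (P : V → V → List D) (hP : G.IsShortestPathSystem w T P)
    (t : V) (ht : t ∈ T) :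
    {p : List D | ∃ t' ∈ T, G.IsCritical o S P t t' ∧ p = P t t'}.ncard + 4 ≤ 8 * S.card := by

  have hpos : 0 < S.card := by
    obtain ⟨F, hF, -⟩ := hS.terminal_onFace t ht
    exact Finset.card_pos.2 ⟨F, hF⟩
  set N : Set D := {d : D | G.faceOf d ∈ S ∧ ¬ G.EquivalentAlong o S P t d} with hN
  have hcard : N.ncard ≤ 2 * S.card := EmbeddedGraph.ncard_inequivalent_le hG o hS hP ht
  have hsub : {p : List D | ∃ t' ∈ T, G.IsCritical o S P t t' ∧ p = P t t'} ⊆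
      (fun d => P t (G.src d)) '' N ∪ (fun d => P t (G.src (G.facePerm d))) '' N := by
    rintro p ⟨t', -, ⟨d, hd, -, rfl, h | h⟩, rfl⟩
    · exact Or.inl ⟨d, ⟨hd, h⟩, rfl⟩
    · refine Or.inr ⟨G.facePerm.symm d, ⟨?_, h⟩, by simp⟩
      rw [← EmbeddedGraph.faceOf_facePerm, Equiv.apply_symm_apply]
      exact hd
  have h1 := Set.ncard_le_ncard hsub (Set.toFinite _)
  have h2 := Set.ncard_union_le ((fun d => P t (G.src d)) '' N)
    ((fun d => P t (G.src (G.facePerm d))) '' N)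
  have h3 := Set.ncard_image_le (f := fun d => P t (G.src d)) (Set.toFinite N)
  have h4 := Set.ncard_image_le (f := fun d => P t (G.src (G.facePerm d))) (Set.toFinite N)
  omega
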